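/- Conventions. A represented space $\mathbf X$ is a set $X$ with a partial surjection $\delta:\subseteq\mathbb N^{\mathbb N}\to X$; if $\delta(p)=x$, then $p$ is called a name of $x$. A map between represented spaces is computable if some computable partial function on $\mathbb N^{\mathbb N}$ takes every name of an argument to a name of its value. $\mathbb S$ is Sierpiński space (a name of $\top$ is a sequence with a non-zero entry), and $\mathcal O(\mathbf X)$ is the represented space of open sets, i.e. of continuously realizable maps $\mathbf X\to\mathbb S$. A compact set $K\subseteq X$ is given by a name of $\{U\mid K\subseteq U\}\in\mathcal O(\mathcal O(\mathbf X))$; $\mathcal V(\mathbf X)$ is the represented space of overt sets: its members are closed sets $A$, given by a name of $\{U\mid U\cap A\neq\emptyset\}\in\mathcal O(\mathcal O(\mathbf X))$. An effective relatively compact system (ercs) of $\mathbf X$ is a triple $((U_n)_{n\in\mathbb N},(B_n)_{n\in\mathbb N},R)$ of a computable sequence of open sets $U_n\in\mathcal O(\mathbf X)$, a computable sequence of compact sets $B_n\subseteq X$, and a computably enumerable relation $R\subseteq\mathbb N\times\mathbb N$ (write $U_m\ll B_n$ for $(m,n)\in R$) such that $U_m\ll B_n$ implies $U_m\subseteq B_n$,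 and such that for every open $U$ $$U=\bigcup_{\{n\mid B_n\subseteq U\}}\ \bigcup_{\{m\mid (m,n)\in R\}}U_m .$$ Theorem. Let $\mathbf X$ be a represented space with an ercs $((U_n)_n,(B_n)_n,R)$. Call $p\in\{0,1\}^{\mathbb N}$ consistent if, whenever $p(n)=1$, $U_n\ll B_k$ and $B_k\subseteq\bigcup_{i\in F}U_i$ for a (possibly empty) finite set $F\subseteq\mathbb N$, then $p(i)=1$ for some $i\in F$. 1. The set of consistent $p$ is (lightface) $\Pi^0_1$ in $\{0,1\}^{\mathbb N}$, i.e. its complement is the union of a computably enumerable family of cylinders. 2. If $A\subseteq X$ is any set and $p(n)=1\Leftrightarrow A\cap U_n\neq\emptyset$ for all $n$, then $p$ is consistent. 3. Every consistent $p$ uniformly defines an overt set: there is a computable map $p\mapsto A_p$ from the subspace of consistent $p$ in $\{0,1\}^{\mathbb N}$ to $\mathcal V(\mathbf X)$ such that, for every consistent $p$ and every open $V$, $$V\cap A_p\neq\emptyset\iff\exists n,\ell\in\mathbb N\ \bigl(p(n)=1,\ U_n\ll B_\ell\text{ and }B_\ell\subseteq V\bigr).$$ 4. Moreover, $X\setminus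 A_p=\bigcup_{\{n\mid p(n)=0\}}U_n$ for every consistent $p$. -/

import Mathlib

universe u v

namespace TTE

/-! ### Represented spaces and computable maps -/

/-- A representation of `X`: a partial surjection from Baire space `ℕ → ℕ` onto `X`, given by its
graph (`Names p x` means that `p` is a name of `x`). -/
structure Representation (X : Type u) where
  /-- `p` is a name of `x` -/
  Names : (ℕ → ℕ) → X → Prop
  unique : ∀ p x y, Names p x → Names p y → x = y
  surj : ∀ x, ∃ p, Names p x

/-- The word `p 0, …, p (k - 1)`. -/
def pref {α : Type u} (p : ℕ → α) (k : ℕ) : List α := (List.range k).map p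

/-- Kleene application on Baire space, `q | p = r`. The value `r n` is found by reading longer and
longer prefixes of `p`: for the least `k` with `q ⟨n, p 0, …, p (k - 1)⟩ ≠ 0`, that number is
`r n + 1`. The partial functions `p ↦ q | p` with `q` computable are, up to restriction of the
domain, the computable partial functions on Baire space (those of an oracle or type-2 machine);
with `q` arbitrary they are, up to restriction, the continuous ones. -/
def Applies (q p r : ℕ → ℕ) : Prop :=
  ∀ n, ∃ k, q (Encodable.encode (n :: pref p k)) = r n + 1 ∧
    ∀ j < k, q (Encodable.encode (n :: pref p j)) = 0

/-- `q` realizes `f : X → Y`: it takes every name of `x` to a name of `f x`. -/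
def Realizes {X : Type u} {Y : Type v} (δX : Representation X) (δY : Representation Y)
    (q : ℕ → ℕ) (f : X → Y) : Prop :=
  ∀ p x, δX.Names p x → ∃ r, Applies q p r ∧ δY.Names r (f x)

/-- A map between represented spaces is computable if it has a computable realizer. -/
def IsComputableMap {X : Type u} {Y : Type v} (δX : Representation X) (δY : Representation Y)
    (f : X → Y) : Prop :=
  ∃ q : ℕ → ℕ, Computable q ∧ Realizes δX δY q f

/-- A computable sequence in a represented space: names of the members can be computed
uniformly in the index. -/
def IsComputableSeq {X : Type u} (δ : Representation X) (x : ℕ → X) : Prop :=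
  ∃ s : ℕ → ℕ → ℕ, Computable₂ s ∧ ∀ n, δ.Names (s n) (x n)

/-- Subspaces of represented spaces. -/
def Representation.subspace {X : Type u} (δ : Representation X) (S : Set X) :
    Representation {x : X // x ∈ S} where
  Names p x := δ.Names p x.1
  unique p x y hx hy := Subtype.ext (δ.unique p x.1 y.1 hx hy)
  surj x := δ.surj x.1

/-- Cantor space, represented by its inclusion in Baire space. -/
def cantor : Representation (ℕ → Bool) where
  Names p x := ∀ n, p n = (x n).toNat
  unique p x y hx hy := by
    funext n
    have h := (hx n).symm.trans (hy n)
    revert h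
    cases x n <;> cases y n <;> simp
  surj x := ⟨fun n => (x n).toNat, fun _ => rfl⟩

/-- Sierpinski space, on the truth values: `p` names `True` iff some `p n` is not `0`. -/
def sierpinski : Representation Prop where
  Names p s := s ↔ ∃ n, p n ≠ 0
  unique p s t hs ht := propext (hs.trans ht.symm)
  surj s := by
    by_cases h : s
    · exact ⟨fun _ => 1, by simp [h]⟩
    · exact ⟨fun _ => 0, by simp [h]⟩

/-! ### Hyperspaces -/

/-- The open subsets of a represented space: the sets whose characteristic map into
Sierpinski space is continuously realizable. -/
def Opens {X : Type u} (δ : Representation X) : Type u :=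
  {U : Set X // ∃ q, Realizes δ sierpinski q (fun x => x ∈ U)}

/-- The space `𝒪(X)` of open sets, as the space of continuously realizable maps from `X` to
Sierpinski space: a name of `U` is a realizer of its characteristic map. -/
def openRep {X : Type u} (δ : Representation X) : Representation (Opens δ) where
  Names q U := Realizes δ sierpinski q (fun x => x ∈ U.1)
  unique q U V hU hV := by
    apply Subtype.ext
    ext x
    obtain ⟨p, hp⟩ := δ.surj x
    obtain ⟨r, hr, hrU⟩ := hU p x hp
    obtain ⟨r', hr', hrV⟩ := hV p x hp
    have e : r = r' := by
      funext n
      obtain ⟨k, hk, hk'⟩ := hr n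
      obtain ⟨l, hl, hl'⟩ := hr' n
      rcases lt_trichotomy k l with h | h | h
      · have := hl' k h
        omega
      · subst h
        omega
      · have := hk' l h
        omega
    subst e
    exact hrU.trans hrV.symm
  surj U := U.2

/-- `q` is a name of `K` as a compact set, i.e. a name of `{U | K ⊆ U}` as a member of `𝒪(𝒪(X))`.
A set with such a name has the same names as its saturation; it need not itself be saturated. -/
def IsCompactName {X : Type u} (δ : Representation X) (q : ℕ → ℕ) (K : Set X) : Prop :=
  Realizes (openRep δ) sierpinski q (fun U => K ⊆ U.1)

/-- `q` is a name of `A` as an overt set, i.e. a name of `{U | U ∩ A ≠ ∅}` as a member of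
`𝒪(𝒪(X))`. -/
def IsOvertName {X : Type u} (δ : Representation X) (q : ℕ → ℕ) (A : Set X) : Prop :=
  Realizes (openRep δ) sierpinski q (fun U => (U.1 ∩ A).Nonempty)

/-- The members of `𝒱(X)`. A set and its closure meet the same open sets, so each is taken to be
closed. -/
def OvertSets {X : Type u} (δ : Representation X) : Type u :=
  {A : Set X // (∃ U : Opens δ, U.1 = Aᶜ) ∧ ∃ q, IsOvertName δ q A}

/-- The space `𝒱(X)` of overt sets. -/
def overtRep {X : Type u} (δ : Representation X) : Representation (OvertSets δ) where
  Names q A := IsOvertName δ q A.1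
  unique q A B hA hB := by
    have key : ∀ U : Opens δ, (U.1 ∩ A.1).Nonempty = (U.1 ∩ B.1).Nonempty := by
      have h := (openRep (openRep δ)).unique q
        ⟨{U | (U.1 ∩ A.1).Nonempty}, ⟨q, hA⟩⟩ ⟨{U | (U.1 ∩ B.1).Nonempty}, ⟨q, hB⟩⟩ hA hB
      intro U
      exact congrFun (congrArg Subtype.val h) U
    have sub : ∀ A B : OvertSets δ,
        (∀ U : Opens δ, (U.1 ∩ A.1).Nonempty = (U.1 ∩ B.1).Nonempty) → A.1 ⊆ B.1 := by
      intro A B h x hx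
      by_contra hxB
      obtain ⟨U, hU⟩ := B.2.1
      have h1 : (U.1 ∩ A.1).Nonempty := ⟨x, by rw [hU]; exact hxB, hx⟩
      rw [h U, hU] at h1
      obtain ⟨y, hy, hy'⟩ := h1
      exact hy hy'
    exact Subtype.ext (Set.Subset.antisymm (sub A B key) (sub B A fun U => (key U).symm))
  surj A := A.2.2

/-! ### Effective relatively compact systems -/

/-- An effective relatively compact system of a represented space. -/
structure ERCS {X : Type u} (δ : Representation X) where
  /-- the open sets -/
  U : ℕ → Opens δ
  /-- the compact sets -/
  B : ℕ → Set X
  /-- formal containment: `R m n` is written `U m ≪ B n` in the literature -/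
  R : ℕ → ℕ → Prop
  computable_U : IsComputableSeq (openRep δ) U
  computable_B : ∃ b : ℕ → ℕ → ℕ, Computable₂ b ∧ ∀ n, IsCompactName δ (b n) (B n)
  re_R : REPred fun mn : ℕ × ℕ => R mn.1 mn.2
  subset_of_R : ∀ m n, R m n → (U m).1 ⊆ B n
  main : ∀ V : Opens δ, V.1 = {x | ∃ n, B n ⊆ V.1 ∧ ∃ m, R m n ∧ x ∈ (U m).1}

/-- `p` is consistent: if `p n = 1`, `U n ≪ B k` and `B k` is covered by finitely many of the basic
open sets (possibly none, when `B k` is empty), then `p i = 1` for the index `i` of one of them. -/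
def ERCS.Consistent {X : Type u} {δ : Representation X} (E : ERCS δ) (p : ℕ → Bool) : Prop :=
  ∀ n k, ∀ F : Finset ℕ, p n = true → E.R n k → E.B k ⊆ ⋃ i ∈ F, (E.U i).1 →
    ∃ i ∈ F, p i = true

/-- (Lightface) `Π⁰₁` subsets of Cantor space: the complement is the union of a computably
enumerable family of cylinders. -/
def IsPi01 (S : Set (ℕ → Bool)) : Prop :=
  ∃ W : List Bool → Prop, REPred W ∧ ∀ p, p ∈ S ↔ ∀ k, ¬ W (pref p k)

end TTE

/-! The engine is a finite subcover principle, `IsCompactName.exists_finset`: a name of a compact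
set accepts a countable union of the `U i` after reading finitely many entries of a suitable name of
that union, and those entries involve only finitely many `U i`.

Inconsistency of `p` therefore has finite evidence: `p n = 1`, `U n ≪ B k`, and `B k` is covered by
those `U i` for which a finite prefix of `p` already shows `p i = 0`.

Let `A_p` be the complement of the union of all `U i` with `p i = 0`. If an open `V` meets `A_p` in
`x`, the system yields `x ∈ U n`, `U n ≪ B l`, `B l ⊆ V`, and `p n = 1` because `x` avoids the
discarded sets. Conversely, given such `n` and `l`, if `V` missed `A_p`, then `B l` would be covered
by finitely many `U i` with `p i = 0`, against consistency (`inter_closedSet_nonempty`). The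
resulting criterion is semidecidable from names of `p` and `V`, so searching for `n` and `l`
computes an overt name (`isOvertName_closedSet`). -/

namespace TTE

/-! ### Bounded search and computability -/

/-- Bounded search: whether `f i` holds for some `i < n`. -/
def bex (f : ℕ → Bool) (n : ℕ) : Bool :=
  n.rec (motive := fun _ => Bool) false fun i ih => ih || f i

theorem bex_eq_true {f : ℕ → Bool} {n : ℕ} : bex f n = true ↔ ∃ i < n, f i = true := by
  induction n with
  | zero => simp [bex]
  | succ n ih =>
    have hs : bex f (n + 1) = (bex f n || f n) := rfl
    rw [hs, Bool.or_eq_true, ih]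
    constructor
    · rintro (⟨i, hi, h⟩ | h)
      · exact ⟨i, by omega, h⟩
      · exact ⟨n, by omega, h⟩
    · rintro ⟨i, hi, h⟩
      rcases Nat.lt_succ_iff_lt_or_eq.1 hi with hi | rfl
      · exact .inl ⟨i, hi, h⟩
      · exact .inr h

theorem bex_congr {f g : ℕ → Bool} {n : ℕ} (h : ∀ i < n, f i = g i) : bex f n = bex g n := by
  rw [Bool.eq_iff_iff, bex_eq_true, bex_eq_true]
  exact exists_congr fun i => and_congr_right fun hi => by rw [h i hi]

section Computability

variable {α : Type*} [Primcodable α]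

theorem computable_and {f g : α → Bool} (hf : Computable f) (hg : Computable g) :
    Computable fun a => f a && g a :=
  (Primrec.and.to_comp (α := Bool) (β := Bool)).comp hf hg

theorem computable_decide_eq {β : Type*} [Primcodable β] [DecidableEq β] {f g : α → β}
    (hf : Computable f) (hg : Computable g) : Computable fun a => decide (f a = g a) :=
  (Primrec.eq (α := β)).decide.to_comp.comp hf hg

theorem computable_bex {f : α → ℕ → Bool} {n : α → ℕ} (hf : Computable₂ f) (hn : Computable n) :
    Computable fun a => bex (f a) (n a) :=
  Computable.nat_rec (h := fun a x => x.2 || f a x.1) hn (Computable.const false)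
    ((Primrec.or.to_comp (α := Bool) (β := Bool)).comp (Computable.snd.comp Computable.snd)
      (hf.comp Computable.fst (Computable.fst.comp Computable.snd)))

theorem computable_pref {u : α → ℕ → ℕ} {n : α → ℕ} (hu : Computable₂ u) (hn : Computable n) :
    Computable fun a => pref (u a) (n a) := by
  refine (Computable.nat_rec (σ := List ℕ) hn (Computable.const [])
    (h := fun a x => x.2 ++ [u a x.1])
    (Computable.list_concat.comp (Computable.snd.comp Computable.snd)
      (hu.comp Computable.fst (Computable.fst.comp Computable.snd)))).of_eq fun a => ?_
  induction n a with
  | zero => rfl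
  | succ k ih =>
    simp only [ih]
    simp [pref, List.range_succ]

/-- Recursively enumerable predicates are those with a computable stagewise approximation. -/
theorem exists_stage_of_rePred {P : α → Prop} (h : REPred P) :
    ∃ f : α → ℕ → Bool, Computable₂ f ∧ ∀ a, P a ↔ ∃ s, f a s = true := by
  obtain ⟨c, hc⟩ := Nat.Partrec.Code.exists_code.1 h
  refine ⟨fun a s => (Nat.Partrec.Code.evaln s c (Encodable.encode a)).isSome, ?_, fun a => ?_⟩
  · exact (Primrec.option_isSome.comp (Nat.Partrec.Code.primrec_evaln.comp
      ((Primrec.snd.pair (Primrec.const c)).pair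
        (Primrec.encode.comp Primrec.fst)))).to_comp
  · have key : P a ↔ (c.eval (Encodable.encode a)).Dom := by
      rw [hc]
      simp [Part.assert, Part.bind, Part.map]
    rw [key, Part.dom_iff_mem]
    constructor
    · rintro ⟨y, hy⟩
      obtain ⟨s, hs⟩ := Nat.Partrec.Code.evaln_complete.1 hy
      exact ⟨s, Option.isSome_iff_exists.2 ⟨y, hs⟩⟩
    · rintro ⟨s, hs⟩
      obtain ⟨y, hy⟩ := Option.isSome_iff_exists.1 hs
      exact ⟨y, Nat.Partrec.Code.evaln_complete.2 ⟨s, hy⟩⟩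

theorem rePred_exists {f : α → ℕ → Bool} (hf : Computable₂ f) :
    REPred fun a => ∃ n, f a n = true := by
  have h := (Partrec.rfind (p := fun a n => (f a n : Part Bool)) hf.partrec₂).dom_re
  refine h.of_eq fun a => Nat.rfind_dom.trans ?_
  constructor
  · rintro ⟨n, hn, -⟩
    exact ⟨n, (Part.mem_some_iff.1 hn).symm⟩
  · rintro ⟨n, hn⟩
    exact ⟨n, Part.mem_some_iff.2 hn.symm, fun _ => trivial⟩

end Computability

/-! ### Words and prefixes -/

@[simp]
theorem length_pref {α : Type*} (p : ℕ → α) (k : ℕ) : (pref p k).length = k := by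
  simp [pref]

theorem pref_getElem? {α : Type*} (p : ℕ → α) {i k : ℕ} (h : i < k) :
    (pref p k)[i]? = some (p i) := by
  simp [pref, h]

theorem pref_getElem?_eq_some {α : Type*} {p : ℕ → α} {i k : ℕ} {a : α} :
    (pref p k)[i]? = some a ↔ i < k ∧ p i = a := by
  by_cases h : i < k
  · rw [pref_getElem? p h]
    simp [h]
  · simp [pref, h]

theorem take_pref {α : Type*} (p : ℕ → α) {i k : ℕ} (h : i ≤ k) :
    (pref p k).take i = pref p i := by
  simp [pref, ← List.map_take, List.take_range, h]

theorem pref_congr {α : Type*} {p q : ℕ → α} {k : ℕ} (h : ∀ i < k, p i = q i) :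
    pref p k = pref q k :=
  List.map_congr_left fun i hi => h i (List.mem_range.1 hi)

theorem lt_encode_cons (m : ℕ) (w : List ℕ) : m < Encodable.encode (m :: w) := by
  rw [Encodable.encode_list_cons]
  exact Nat.lt_succ_of_le (Nat.left_le_pair _ _)

/-! ### Realizers whose `m`-th output is computed from the first `m` inputs -/

/-- The realizer whose `m`-th output is `g m w`, where `w` consists of the first `m` inputs. -/
def timed (g : ℕ → List ℕ → ℕ) (c : ℕ) : ℕ :=
  bif (Denumerable.ofNat (List ℕ) c).length == (Denumerable.ofNat (List ℕ) c).headI + 1 then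
    g (Denumerable.ofNat (List ℕ) c).headI (Denumerable.ofNat (List ℕ) c).tail + 1 else 0

theorem timed_encode_cons (g : ℕ → List ℕ → ℕ) (m : ℕ) (w : List ℕ) :
    timed g (Encodable.encode (m :: w)) = if w.length = m then g m w + 1 else 0 := by
  have h : Denumerable.ofNat (List ℕ) (Encodable.encode (m :: w)) = m :: w :=
    Denumerable.ofNat_encode _
  simp only [timed, h, List.headI_cons, List.tail_cons, List.length_cons]
  by_cases hw : w.length = m
  · simp [hw]
  · have h' : (w.length + 1 == m + 1) = false := by simpa using hw
    rw [h', if_neg hw, cond_false]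

/-- The code of `m :: w` exceeds `m`, so entries below `n` consult `g m` only for `m < n`. -/
theorem timed_congr {g g' : ℕ → List ℕ → ℕ} {n : ℕ} (h : ∀ m < n, ∀ w, g m w = g' m w)
    {c : ℕ} (hc : c < n) : timed g c = timed g' c := by
  obtain ⟨l, rfl⟩ : ∃ l : List ℕ, Encodable.encode l = c := ⟨_, Denumerable.encode_ofNat c⟩
  cases l with
  | nil => simp [timed]
  | cons m w => rw [timed_encode_cons, timed_encode_cons, h m ((lt_encode_cons m w).trans hc) w]

theorem applies_timed (g : ℕ → List ℕ → ℕ) (p : ℕ → ℕ) :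
    Applies (timed g) p fun m => g m (pref p m) := fun m =>
  ⟨m, by rw [timed_encode_cons, if_pos (length_pref p m)], fun j hj => by
    rw [timed_encode_cons, if_neg (by simpa using hj.ne)]⟩

theorem computable_timed {α : Type*} [Primcodable α] {g : α → ℕ → List ℕ → ℕ}
    (hg : Computable fun x : α × ℕ × List ℕ => g x.1 x.2.1 x.2.2) :
    Computable₂ fun a c => timed (g a) c := by
  have hl : Computable fun x : α × ℕ => Denumerable.ofNat (List ℕ) x.2 :=
    (Primrec.ofNat (List ℕ)).to_comp.comp Computable.snd
  have hh := (Primrec.list_headI (α := ℕ)).to_comp.comp hl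
  have ht := (Primrec.list_tail (α := ℕ)).to_comp.comp hl
  exact Computable.cond
    ((Primrec.beq (α := ℕ)).to_comp.comp ((Primrec.list_length (α := ℕ)).to_comp.comp hl)
      (Computable.succ.comp hh))
    (Computable.succ.comp (hg.comp (Computable.fst.pair (hh.pair ht)))) (Computable.const 0)

/-! ### Semidecision by realizers of maps into Sierpinski space -/

/-- The realizer `q`, given only the word `w`, produces a non-zero output; `e` codes the index of
the output and the number of symbols read for it. -/
def fires (q : ℕ → ℕ) (w : List ℕ) (e : ℕ) : Bool :=
  decide (e.unpair.2 ≤ w.length) &&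
    (decide (2 ≤ q (Encodable.encode (e.unpair.1 :: w.take e.unpair.2))) &&
      !bex (fun i => !(q (Encodable.encode (e.unpair.1 :: w.take i)) == 0)) e.unpair.2)

theorem fires_pref {q p : ℕ → ℕ} {n e : ℕ} :
    fires q (pref p n) e = true ↔ e.unpair.2 ≤ n ∧
      2 ≤ q (Encodable.encode (e.unpair.1 :: pref p e.unpair.2)) ∧
      ∀ i < e.unpair.2, q (Encodable.encode (e.unpair.1 :: pref p i)) = 0 := by
  simp only [fires, Bool.and_eq_true, decide_eq_true_eq, length_pref, Bool.not_eq_true',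
    ← Bool.not_eq_true, bex_eq_true]
  refine and_congr_right fun h => ?_
  rw [take_pref p h]
  refine and_congr_right fun _ => ?_
  push Not
  refine forall₂_congr fun i hi => ?_
  rw [take_pref p (hi.le.trans h)]
  simp

theorem fires_pref_mono {q p : ℕ → ℕ} {n n' e : ℕ} (hn : n ≤ n')
    (h : fires q (pref p n) e = true) : fires q (pref p n') e = true := by
  rw [fires_pref] at h ⊢
  exact ⟨h.1.trans hn, h.2⟩

/-- An output `r` is stored as `r + 1`, hence the threshold 2 in `fires`. The first non-zero answer
is the one that counts, so a later large value of `q` must not be taken for an output. -/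
theorem Realizes.iff_fires {X : Type*} {δ : Representation X} {q : ℕ → ℕ} {f : X → Prop}
    (h : Realizes δ sierpinski q f) {p : ℕ → ℕ} {x : X} (hp : δ.Names p x) :
    f x ↔ ∃ n e, fires q (pref p n) e = true := by
  obtain ⟨r, hr, hf⟩ := h p x hp
  refine Iff.trans hf ⟨?_, ?_⟩
  · rintro ⟨j, hj⟩
    obtain ⟨k, hk, hk'⟩ := hr j
    exact ⟨k, Nat.pair j k, fires_pref.2 (by
      simp only [Nat.unpair_pair]
      exact ⟨le_rfl, by omega, hk'⟩)⟩
  · rintro ⟨n, e, he⟩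
    obtain ⟨-, h2, h0⟩ := fires_pref.1 he
    refine ⟨e.unpair.1, ?_⟩
    obtain ⟨k, hk, hk'⟩ := hr e.unpair.1
    rcases lt_trichotomy k e.unpair.2 with h | h | h
    · have := h0 k h
      omega
    · rw [← h] at h2
      omega
    · have := hk' _ h
      omega

/-- Only the eventual appearance of a non-zero output matters, so tying the output index to the
number of symbols read loses no semidecision procedure. -/
theorem realizes_timed {X : Type*} {δ : Representation X} {g : ℕ → List ℕ → Bool} {f : X → Prop}
    (h : ∀ p x, δ.Names p x → (f x ↔ ∃ m, g m (pref p m) = true)) :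
    Realizes δ sierpinski (timed fun m w => (g m w).toNat) f := fun p x hp =>
  ⟨_, applies_timed _ p, (h p x hp).trans (exists_congr fun m => by simp)⟩

theorem computable_fires {α : Type*} [Primcodable α] {u : α → ℕ → ℕ} {w : α → List ℕ}
    {e : α → ℕ} (hu : Computable₂ u) (hw : Computable w) (he : Computable e) :
    Computable fun a => fires (u a) (w a) (e a) := by
  have h1 : Computable fun a => (e a).unpair.1 :=
    Computable.fst.comp (Computable.unpair.comp he)
  have h2 : Computable fun a => (e a).unpair.2 :=
    Computable.snd.comp (Computable.unpair.comp he)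
  have hq : Computable₂ fun a i => u a (Encodable.encode ((e a).unpair.1 :: (w a).take i)) :=
    hu.comp Computable.fst (Computable.encode.comp (Computable.list_cons.comp
      (h1.comp Computable.fst)
      ((Primrec.list_take (α := ℕ)).to_comp.comp Computable.snd (hw.comp Computable.fst))))
  have hle : Computable₂ fun a b : ℕ => decide (a ≤ b) := Primrec.nat_le.decide.to_comp
  refine computable_and (hle.comp h2 ((Primrec.list_length (α := ℕ)).to_comp.comp hw))
    (computable_and (hle.comp (Computable.const 2) (hq.comp Computable.id h2)) ?_)
  exact Primrec.not.to_comp.comp (computable_bex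
    (Primrec.not.to_comp.comp ((Primrec.beq (α := ℕ)).to_comp.comp hq (Computable.const 0))) h2)

/-! ### Unions of open sets and compactness -/

/-- A name of the union of the open sets named by the `s i` with `S i = true`. -/
def unionName (s : ℕ → ℕ → ℕ) (S : ℕ → Bool) : ℕ → ℕ :=
  timed fun m w => (bex (fun e => S e.unpair.1 && fires (s e.unpair.1) w e.unpair.2) m).toNat

/-- The search at stage `m` inspects only indices below `m`; a finite part of the name thus depends
on a finite part of `S`. Finite subcovers come from this. -/
theorem unionName_congr {s : ℕ → ℕ → ℕ} {S S' : ℕ → Bool} {n : ℕ} (h : ∀ i < n, S i = S' i)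
    {c : ℕ} (hc : c < n) : unionName s S c = unionName s S' c :=
  timed_congr (fun m hm w => congrArg Bool.toNat (bex_congr fun e he => by
    rw [h _ ((Nat.unpair_left_le e).trans_lt (he.trans hm))])) hc

theorem computable_unionName {α : Type*} [Primcodable α] {s : ℕ → ℕ → ℕ} {S : α → ℕ → Bool}
    (hs : Computable₂ s) (hS : Computable₂ S) : Computable₂ fun a => unionName s (S a) := by
  have hi : Computable fun x : (α × ℕ × List ℕ) × ℕ => x.2.unpair.1 :=
    Computable.fst.comp (Computable.unpair.comp Computable.snd)
  refine computable_timed ((Primrec.dom_finite Bool.toNat).to_comp.comp (computable_bex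
    (computable_and (hS.comp (Computable.fst.comp Computable.fst) hi)
      (computable_fires (hs.comp (hi.comp Computable.fst) Computable.snd)
        (Computable.snd.comp (Computable.snd.comp Computable.fst))
        (Computable.snd.comp (Computable.unpair.comp Computable.snd))))
    (Computable.fst.comp Computable.snd)))

section Union

variable {X : Type*} {δ : Representation X} {U : ℕ → Opens δ} {s : ℕ → ℕ → ℕ}

theorem realizes_unionName (hs : ∀ i, (openRep δ).Names (s i) (U i)) (S : ℕ → Bool) :
    Realizes δ sierpinski (unionName s S) fun x => x ∈ ⋃ i ∈ {i | S i = true}, (U i).1 := by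
  refine realizes_timed fun p x hp => ?_
  simp only [Set.mem_iUnion, Set.mem_ofPred_eq, exists_prop, bex_eq_true, Bool.and_eq_true]
  constructor
  · rintro ⟨i, hi, hx⟩
    obtain ⟨n, e, he⟩ := (Realizes.iff_fires (hs i) hp).1 hx
    exact ⟨max n (Nat.pair i e + 1), Nat.pair i e, by omega, by simpa using hi,
      by simpa using fires_pref_mono (le_max_left _ _) he⟩
  · rintro ⟨m, e, -, hi, he⟩
    exact ⟨_, hi, (Realizes.iff_fires (hs _) hp).2 ⟨m, _, he⟩⟩

/-- The union of the open sets `U i` with `S i = true`. -/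
def unionOpens (hs : ∀ i, (openRep δ).Names (s i) (U i)) (S : ℕ → Bool) : Opens δ :=
  ⟨⋃ i ∈ {i | S i = true}, (U i).1, unionName s S, realizes_unionName hs S⟩

theorem names_unionOpens (hs : ∀ i, (openRep δ).Names (s i) (U i)) (S : ℕ → Bool) :
    (openRep δ).Names (unionName s S) (unionOpens hs S) :=
  realizes_unionName hs S

theorem IsCompactName.subset_iUnion_iff {b : ℕ → ℕ} {K : Set X} (hb : IsCompactName δ b K)
    (hs : ∀ i, (openRep δ).Names (s i) (U i)) (S : ℕ → Bool) :
    K ⊆ ⋃ i ∈ {i | S i = true}, (U i).1 ↔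
      ∃ n e, fires b (pref (unionName s S) n) e = true :=
  Realizes.iff_fires hb (names_unionOpens hs S)

/-- Compact sets have finite subcovers of countable covers by open sets. -/
theorem IsCompactName.exists_finset {b : ℕ → ℕ} {K : Set X} (hb : IsCompactName δ b K)
    (hs : ∀ i, (openRep δ).Names (s i) (U i)) {S : ℕ → Bool}
    (hK : K ⊆ ⋃ i ∈ {i | S i = true}, (U i).1) :
    ∃ F : Finset ℕ, (∀ i ∈ F, S i = true) ∧ K ⊆ ⋃ i ∈ F, (U i).1 := by
  obtain ⟨n, e, he⟩ := (hb.subset_iUnion_iff hs S).1 hK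
  -- The accepted prefix is also a prefix of a name of the union over `i < n` with `S i = true`, so
  -- `b` must accept that finite union too.
  have h : pref (unionName s S) n = pref (unionName s fun i => S i && decide (i < n)) n :=
    pref_congr fun c hc => unionName_congr (fun i hi => by simp [hi]) hc
  rw [h] at he
  refine ⟨(Finset.range n).filter fun i => S i = true, fun i hi => (Finset.mem_filter.1 hi).2,
    ((hb.subset_iUnion_iff hs _).2 ⟨n, e, he⟩).trans ?_⟩
  refine Set.iUnion₂_subset fun i hi => ?_
  simp only [Set.mem_ofPred_eq, Bool.and_eq_true, decide_eq_true_eq] at hi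
  exact Set.subset_biUnion_of_mem (u := fun i => (U i).1)
    (Finset.mem_coe.2 (Finset.mem_filter.2 ⟨Finset.mem_range.2 hi.2, hi.1⟩))

end Union

/-! ### Consistent sequences -/

namespace ERCS

variable {X : Type*} {δ : Representation X} (E : ERCS δ)

theorem consistent_of_hits {A : Set X} {p : ℕ → Bool}
    (hp : ∀ n, p n = true ↔ (A ∩ (E.U n).1).Nonempty) : E.Consistent p := by
  intro n k F hn hR hF
  obtain ⟨x, hxA, hx⟩ := (hp n).1 hn
  obtain ⟨i, hi, hxi⟩ := Set.mem_iUnion₂.1 (hF (E.subset_of_R n k hR hx))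
  exact ⟨i, hi, (hp i).2 ⟨x, hxA, hxi⟩⟩

theorem isPi01_consistent : IsPi01 {p | E.Consistent p} := by
  obtain ⟨s, hsc, hs⟩ := E.computable_U
  obtain ⟨b, hbc, hb⟩ := E.computable_B
  obtain ⟨ρ, hρc, hρ⟩ := exists_stage_of_rePred E.re_R
  -- Positions beyond the end of `w` give `none`, so only zeros already read are selected.
  let S : List Bool → ℕ → Bool := fun w i => decide (w[i]? = some false)
  -- the numbers `n`, `k`, a stage of the enumeration of `R`, a length and a stage for `fires`
  let D : ℕ → ℕ × ℕ × ℕ × ℕ × ℕ := Denumerable.ofNat _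
  let W : List Bool → ℕ → Bool := fun w c =>
    decide (w[(D c).1]? = some true) && (ρ ((D c).1, (D c).2.1) (D c).2.2.1 &&
      fires (b (D c).2.1) (pref (unionName s (S w)) (D c).2.2.2.1) (D c).2.2.2.2)
  have hSc : Computable₂ S :=
    computable_decide_eq (α := List Bool × ℕ) (f := fun x => x.1[x.2]?)
      Computable.list_getElem? (Computable.const (some false))
  have hWc : Computable₂ W := by
    have hD : Computable fun x : List Bool × ℕ => D x.2 :=
      (Primrec.ofNat _).to_comp.comp Computable.snd
    have h1 := Computable.fst.comp hD
    have hD2 := Computable.snd.comp hD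
    have h2 := Computable.fst.comp hD2
    have hD3 := Computable.snd.comp hD2
    have h3 := Computable.fst.comp hD3
    have hD4 := Computable.snd.comp hD3
    refine computable_and (computable_decide_eq
        (Computable.list_getElem?.comp Computable.fst h1) (Computable.const _))
      (computable_and (hρc.comp (h1.pair h2) h3) (computable_fires
        (hbc.comp (h2.comp Computable.fst) Computable.snd)
        (computable_pref ((computable_unionName hsc hSc).comp
          (Computable.fst.comp Computable.fst) Computable.snd) (Computable.fst.comp hD4))
        (Computable.snd.comp hD4)))
  refine ⟨_, rePred_exists hWc, fun p => ?_⟩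
  have hS : ∀ N i, S (pref p N) i = true ↔ i < N ∧ p i = false := fun N i => by
    simp only [S, decide_eq_true_eq, pref_getElem?_eq_some]
  simp only [Set.mem_ofPred_eq]
  constructor
  · rintro hp N ⟨c, hc⟩
    simp only [W, Bool.and_eq_true, decide_eq_true_eq, pref_getElem?_eq_some] at hc
    generalize D c = d at hc
    obtain ⟨n, k, t, l, e⟩ := d
    obtain ⟨⟨-, hn⟩, hR, hf⟩ := hc
    have hcov := ((hb k).subset_iUnion_iff hs _).2 ⟨l, e, hf⟩
    obtain ⟨F, hF, hK⟩ := (hb k).exists_finset hs hcov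
    obtain ⟨i, hi, hpi⟩ := hp n k F hn ((hρ (n, k)).2 ⟨t, hR⟩) hK
    have := ((hS N i).1 (hF i hi)).2
    simp [hpi] at this
  · intro h n k F hn hR hF
    by_contra! hpF
    obtain ⟨t, ht⟩ := (hρ (n, k)).1 hR
    -- Long enough to display `p n` and `p i` for every `i ∈ F`; the supremum is 0 when `F` is
    -- empty.
    set N := max (n + 1) (F.sup id + 1) with hN
    have hcov : E.B k ⊆ ⋃ i ∈ {i | S (pref p N) i = true}, (E.U i).1 := by
      refine hF.trans (Set.iUnion₂_subset fun i hi => ?_)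
      have hle : i ≤ F.sup id := Finset.le_sup (f := id) hi
      exact Set.subset_biUnion_of_mem (u := fun i => (E.U i).1)
        ((hS N i).2 ⟨by omega, by simpa using hpF i hi⟩)
    obtain ⟨l, e, he⟩ := ((hb k).subset_iUnion_iff hs _).1 hcov
    refine h N ⟨Encodable.encode (n, k, t, l, e), ?_⟩
    have hD : D (Encodable.encode (n, k, t, l, e)) = (n, k, t, l, e) :=
      Denumerable.ofNat_encode _
    simp only [W, hD, Bool.and_eq_true, decide_eq_true_eq, pref_getElem?_eq_some]
    exact ⟨⟨by omega, hn⟩, ht, he⟩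

/-- The closed set defined by a sequence `p`, namely the complement of the union of all `U n` with
`p n = false`. -/
def closedSet (p : ℕ → Bool) : Set X := (⋃ n ∈ {n | p n = false}, (E.U n).1)ᶜ

theorem inter_closedSet_nonempty {p : ℕ → Bool} (hp : E.Consistent p) (V : Opens δ) :
    (V.1 ∩ E.closedSet p).Nonempty ↔ ∃ n l, p n = true ∧ E.R n l ∧ E.B l ⊆ V.1 := by
  constructor
  · rintro ⟨x, hxV, hx⟩
    rw [E.main V] at hxV
    obtain ⟨l, hl, n, hR, hxn⟩ := hxV
    refine ⟨n, l, ?_, hR, hl⟩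
    by_contra hn
    exact hx (Set.mem_biUnion (show n ∈ {n | p n = false} by simpa using hn) hxn)
  · rintro ⟨n, l, hn, hR, hl⟩
    by_contra hV
    rw [Set.not_nonempty_iff_eq_empty, ← Set.disjoint_iff_inter_eq_empty, closedSet,
      Set.disjoint_compl_right_iff_subset] at hV
    obtain ⟨s, -, hs⟩ := E.computable_U
    obtain ⟨b, -, hb⟩ := E.computable_B
    have hcov : E.B l ⊆ ⋃ i ∈ {i | (!p i) = true}, (E.U i).1 := by
      simpa using hl.trans hV
    obtain ⟨F, hF, hK⟩ := (hb l).exists_finset hs hcov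
    obtain ⟨i, hi, hpi⟩ := hp n l F hn hR hK
    simpa [hpi] using hF i hi

theorem exists_opens_eq_compl_closedSet (p : ℕ → Bool) :
    ∃ U : Opens δ, U.1 = (E.closedSet p)ᶜ := by
  obtain ⟨s, -, hs⟩ := E.computable_U
  exact ⟨unionOpens hs fun i => !p i, by simp [unionOpens, closedSet]⟩

/-- The search, up to stage `m`, for `n` and `l` with `p n = true`, `R n l` and `B l` contained in
an open set, given prefixes `w` of `p` and `v` of a name of the open set. -/
def overtSearch (b : ℕ → ℕ → ℕ) (ρ : ℕ × ℕ → ℕ → Bool) (w : List ℕ) (m : ℕ) (v : List ℕ) : Bool :=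
  bex (fun e => decide (w[e.unpair.1]? = some 1) &&
    (ρ (e.unpair.1, e.unpair.2.unpair.1) e.unpair.2.unpair.2.unpair.1 &&
      fires (b e.unpair.2.unpair.1) v e.unpair.2.unpair.2.unpair.2)) m

theorem computable_overtSearch {b : ℕ → ℕ → ℕ} {ρ : ℕ × ℕ → ℕ → Bool} (hb : Computable₂ b)
    (hρ : Computable₂ ρ) :
    Computable fun x : List ℕ × ℕ × List ℕ => overtSearch b ρ x.1 x.2.1 x.2.2 := by
  have hx : Computable fun x : (List ℕ × ℕ × List ℕ) × ℕ => x.2.unpair :=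
    Computable.unpair.comp Computable.snd
  have h1 : Computable fun x : (List ℕ × ℕ × List ℕ) × ℕ => x.2.unpair.1 :=
    Computable.fst.comp hx
  have hx2 : Computable fun x : (List ℕ × ℕ × List ℕ) × ℕ => x.2.unpair.2.unpair :=
    Computable.unpair.comp (Computable.snd.comp hx)
  have h2 : Computable fun x : (List ℕ × ℕ × List ℕ) × ℕ => x.2.unpair.2.unpair.1 :=
    Computable.fst.comp hx2
  have hx3 : Computable fun x : (List ℕ × ℕ × List ℕ) × ℕ =>
      x.2.unpair.2.unpair.2.unpair :=
    Computable.unpair.comp (Computable.snd.comp hx2)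
  exact computable_bex (computable_and (computable_decide_eq
      (Computable.list_getElem?.comp (Computable.fst.comp Computable.fst) h1)
      (Computable.const _))
    (computable_and (hρ.comp (h1.pair h2) (Computable.fst.comp hx3)) (computable_fires
      (hb.comp (h2.comp Computable.fst) Computable.snd)
      (Computable.snd.comp (Computable.snd.comp Computable.fst)) (Computable.snd.comp hx3))))
    (Computable.fst.comp Computable.snd)

/-- The overt name of `E.closedSet p` computed from a name `p'` of `p`. -/
theorem isOvertName_closedSet {b : ℕ → ℕ → ℕ} {ρ : ℕ × ℕ → ℕ → Bool}
    (hb : ∀ n, IsCompactName δ (b n) (E.B n))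
    (hρ : ∀ nl : ℕ × ℕ, E.R nl.1 nl.2 ↔ ∃ t, ρ nl t = true)
    {p : ℕ → Bool} (hp : E.Consistent p) {p' : ℕ → ℕ} (hp' : cantor.Names p' p) :
    IsOvertName δ
      (fun c => timed (fun m v => (overtSearch b ρ (pref p' c) m v).toNat) c)
      (E.closedSet p) := by
  -- The entry at `c` may use `c` symbols of `p'`. Since `c` codes the query `m :: v`, this bound is
  -- itself a function of `m` and `v`, and the name has the form needed for `realizes_timed`.
  have hname : (fun c => timed (fun m v => (overtSearch b ρ (pref p' c) m v).toNat) c) =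
      timed fun m v =>
        (overtSearch b ρ (pref p' (Encodable.encode (m :: v))) m v).toNat := by
    funext c
    obtain ⟨l, rfl⟩ : ∃ l : List ℕ, Encodable.encode l = c := ⟨_, Denumerable.encode_ofNat c⟩
    cases l with
    | nil => simp [timed]
    | cons m v => rw [timed_encode_cons, timed_encode_cons]
  have hp1 : ∀ n, p' n = 1 ↔ p n = true := fun n => by
    rw [hp' n]
    cases p n <;> simp
  rw [hname]
  refine realizes_timed fun v V hv => ?_
  rw [E.inter_closedSet_nonempty hp V]
  simp only [overtSearch, bex_eq_true, Bool.and_eq_true, decide_eq_true_eq, pref_getElem?_eq_some]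
  constructor
  · rintro ⟨n, l, hn, hR, hl⟩
    obtain ⟨t, ht⟩ := (hρ (n, l)).1 hR
    obtain ⟨k, d, hd⟩ := (Realizes.iff_fires (hb l) hv).1 hl
    set e := Nat.pair n (Nat.pair l (Nat.pair t d)) with he
    have hne : n ≤ e := Nat.left_le_pair _ _
    -- The stage must be at least `k` for `fires` and exceed `e` for the search. The code of the
    -- query exceeds the stage, so position `n ≤ e` of `p'` has been read.
    refine ⟨max k (e + 1), e, by omega, ⟨?_, ?_⟩, ?_, ?_⟩
    · have := lt_encode_cons (max k (e + 1)) (pref v (max k (e + 1)))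
      simp only [he, Nat.unpair_pair] at this hne ⊢
      omega
    · simpa [he, hp1] using hn
    · simpa [he] using ht
    · simpa [he] using fires_pref_mono (le_max_left k (e + 1)) hd
  · rintro ⟨m, e, -, ⟨-, hn⟩, hR, hf⟩
    exact ⟨e.unpair.1, e.unpair.2.unpair.1, (hp1 _).1 hn, (hρ (e.unpair.1, e.unpair.2.unpair.1)).2 ⟨_, hR⟩,
      (Realizes.iff_fires (hb _) hv).2 ⟨m, _, hf⟩⟩

theorem exists_isOvertName_closedSet {p : ℕ → Bool} (hp : E.Consistent p) :
    ∃ q, IsOvertName δ q (E.closedSet p) := by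
  obtain ⟨b, -, hb⟩ := E.computable_B
  obtain ⟨ρ, -, hρ⟩ := exists_stage_of_rePred E.re_R
  obtain ⟨p', hp'⟩ := cantor.surj p
  exact ⟨_, E.isOvertName_closedSet hb hρ hp hp'⟩

/-- The overt set defined by a consistent sequence. -/
def overtSet (p : {p : ℕ → Bool // p ∈ {p | E.Consistent p}}) : OvertSets δ :=
  ⟨E.closedSet p.1, E.exists_opens_eq_compl_closedSet p.1, E.exists_isOvertName_closedSet p.2⟩

theorem isComputableMap_overtSet :
    IsComputableMap (cantor.subspace {p | E.Consistent p}) (overtRep δ) E.overtSet := by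
  obtain ⟨b, hbc, hb⟩ := E.computable_B
  obtain ⟨ρ, hρc, hρ⟩ := exists_stage_of_rePred E.re_R
  have hT : Computable₂ fun (w : List ℕ) c =>
      timed (fun m v => (overtSearch b ρ w m v).toNat) c :=
    computable_timed ((Primrec.dom_finite Bool.toNat).to_comp.comp
      (computable_overtSearch hbc hρc))
  -- The outer `timed` reads `c` symbols of `p'` and outputs entry `c` of the overt name; the inner
  -- one evaluates that entry on a prefix of a name of the open set.
  refine ⟨timed fun c w => timed (fun m v => (overtSearch b ρ w m v).toNat) c, ?_, ?_⟩
  · exact (computable_timed (α := Unit)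
      (g := fun _ c w => timed (fun m v => (overtSearch b ρ w m v).toNat) c)
      (hT.comp (Computable.snd.comp Computable.snd) (Computable.fst.comp Computable.snd))).comp
      (Computable.const ()) Computable.id
  · intro p' p hp'
    exact ⟨_, applies_timed _ p', E.isOvertName_closedSet hb hρ p.2 hp'⟩

end ERCS

end TTE

theorem theorem24 {X : Type u} (δ : TTE.Representation X) (E : TTE.ERCS δ) :
    -- the set of consistent sequences is lightface `Π⁰₁`
    TTE.IsPi01 {p | E.Consistent p} ∧
    -- the hits of any set on the basic open sets form a consistent sequence
    (∀ (A : Set X) (p : ℕ → Bool),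
      (∀ n, p n = true ↔ (A ∩ (E.U n).1).Nonempty) → E.Consistent p) ∧
    -- consistent sequences uniformly define overt sets, with the stated complement
    (∃ Φ : {p : ℕ → Bool // p ∈ {p | E.Consistent p}} → TTE.OvertSets δ,
      TTE.IsComputableMap (TTE.cantor.subspace {p | E.Consistent p}) (TTE.overtRep δ) Φ ∧
      ∀ p, (∀ V : TTE.Opens δ, (V.1 ∩ (Φ p).1).Nonempty ↔
              ∃ n l, p.1 n = true ∧ E.R n l ∧ E.B l ⊆ V.1) ∧
           ((Φ p).1)ᶜ = ⋃ n ∈ {n | p.1 n = false}, (E.U n).1) :=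
  ⟨E.isPi01_consistent, fun _ _ h => E.consistent_of_hits h, E.overtSet,
    E.isComputableMap_overtSet,
    fun p => ⟨E.inter_closedSet_nonempty p.2, compl_compl _⟩⟩
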